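/- Fix the scalar field $\mathbb K\in\{\mathbb R,\mathbb C\}$; all Banach spaces are over $\mathbb K$ and operators are bounded linear maps between Banach spaces. For a Banach space $E$ let $B_{E^*}$ be the closed unit ball of $E^*$. For a $w^*$-compact set $K\subseteq E^*$ and $\varepsilon>0$ put $$s_\varepsilon(K)=\{x\in K : \operatorname{diam}(K\cap V)>\varepsilon\text{ for every } w^*\text{-open } V\ni x\},$$ where the diameter is taken in the norm of $E^*$, and define $s_\varepsilon^0(K)=K$, $s_\varepsilon^{\alpha+1}(K)=s_\varepsilon(s_\varepsilon^\alpha(K))$ for every ordinal $\alpha$, and $s_\varepsilon^\alpha(K)=\bigcap_{\beta<\alpha}s_\varepsilon^\beta(K)$ for limit ordinals $\alpha$. The Szlenk index $\mathrm{Sz}(K)$ of $K$ is the class of all ordinals $\alpha$ such that $s_\varepsilon^\alpha(K)\neq\emptyset$ for some $\varepsilon>0$ (either an ordinal or the class of all ordinals). Set $\mathrm{Sz}(E)=\mathrm{Sz}(B_{E^*})$ for a Banach space $E$, and $\mathrm{Sz}(T)=\mathrm{Sz}(T^*B_{F^*})$ for an operator $T:E\to F$. For an ordinal $\alpha$ let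 - $\mathrm{Szl}_\alpha$ be the class of all Banach spaces $E$ with $\mathrm{Sz}(E)\le\omega^\alpha$; - $\mathcal{SZ}_\alpha$ be the class of all operators $T$ with $\mathrm{Sz}(T)\le\omega^\alpha$; - $\mathrm{Pzl}_\alpha$ be the class of all Banach spaces linearly isomorphic to some Banach space $F$ for which there exist $c\in(0,1)$ and $p\ge 1$ such that $s_\varepsilon^{\omega^\alpha}(B_{F^*})\subseteq(1-c\varepsilon^p)B_{F^*}$ for all $\varepsilon\in(0,1)$. A class $\mathcal I$ of operators is said to have the factorization property if every $T:E\to F$ in $\mathcal I$ can be written as $T=BA$ with operators $A:E\to D$ and $B:D\to F$, where $D$ is a Banach space whose identity operator belongs to $\mathcal I$. **Proposition.** Let $\alpha$ be an ordinal. Then at most one of the following two statements holds: (i) $\mathrm{Szl}_{\alpha+1}=\mathrm{Pzl}_\alpha$; (ii) $\mathcal{SZ}_{\alpha+1}$ has the factorization property. -/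

import Mathlib

universe u v

/-- The class of Banach spaces over the scalar field `𝕜` (the real or complex numbers). -/
structure Ban (𝕜 : Type) [RCLike 𝕜] where
  carrier : Type u
  [normedAddCommGroup : NormedAddCommGroup carrier]
  [normedSpace : NormedSpace 𝕜 carrier]
  [completeSpace : CompleteSpace carrier]

namespace Ban

instance (𝕜 : Type) [RCLike 𝕜] : CoeSort (Ban.{u} 𝕜) (Type u) := ⟨Ban.carrier⟩

attribute [instance] Ban.normedAddCommGroup Ban.normedSpace Ban.completeSpace

end Ban

section Szlenk

variable {𝕜 : Type} [RCLike 𝕜]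
variable {E : Type u} [NormedAddCommGroup E] [NormedSpace 𝕜 E]
variable {F : Type u} [NormedAddCommGroup F] [NormedSpace 𝕜 F]

/-- The Szlenk derivation `s_ε(K)` of a set `K` in the dual of `E`: the points of `K` all of whose
weak-star open neighbourhoods `V` satisfy `diam (K ∩ V) > ε` (diameter in the dual norm). -/
def szlenkDerivation (ε : ℝ) (K : Set (StrongDual 𝕜 E)) : Set (StrongDual 𝕜 E) :=
  {x | x ∈ K ∧ ∀ V : Set (WeakDual 𝕜 E), IsOpen V → StrongDual.toWeakDual x ∈ V →
    ENNReal.ofReal ε < Metric.ediam (K ∩ StrongDual.toWeakDual ⁻¹' V)}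

/-- The transfinite iterates `s_ε^α(K)`: `s_ε^0(K) = K`, `s_ε^{α+1}(K) = s_ε(s_ε^α(K))`, and
`s_ε^α(K) = ⋂_{β < α} s_ε^β(K)` for limit `α`. -/
noncomputable def szlenkIter (ε : ℝ) (K : Set (StrongDual 𝕜 E)) (α : Ordinal.{v}) :
    Set (StrongDual 𝕜 E) :=
  Ordinal.limitRecOn α K (fun _ L => szlenkDerivation ε L)
    (fun γ _ s => ⋂ (β : Ordinal.{v}) (h : β < γ), s β h)

/-- The `ε`-Szlenk index of `K`, as the class of all ordinals `α` with `s_ε^α(K) ≠ ∅`. -/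
def epsSzlenkIndex (ε : ℝ) (K : Set (StrongDual 𝕜 E)) : Set Ordinal.{v} :=
  {α | (szlenkIter ε K α).Nonempty}

/-- The Szlenk index of `K`, as a class of ordinals: the union of the `ε`-Szlenk indices, `ε > 0`.
It is an initial segment of the ordinals; it is at most the ordinal `γ` precisely when it is
contained in `γ = Set.Iio γ`. -/
def szlenkIndex (K : Set (StrongDual 𝕜 E)) : Set Ordinal.{v} :=
  ⋃ (ε : ℝ) (_ : 0 < ε), epsSzlenkIndex ε K

/-- The set `T* B` where `B` is the closed unit ball of the dual of `F` and `T*` is the adjoint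
(`T* φ = φ ∘ T`) of the operator `T : E → F`. -/
def adjointImageBall (T : E →L[𝕜] F) : Set (StrongDual 𝕜 E) :=
  (fun φ : StrongDual 𝕜 F => φ.comp T) '' Metric.closedBall (0 : StrongDual 𝕜 F) 1

end Szlenk

section Classes

variable (𝕜 : Type) [RCLike 𝕜]

/-- A class of bounded linear operators between Banach spaces, given by its components. -/
abbrev OperatorClass := ∀ E F : Ban.{u} 𝕜, Set (E →L[𝕜] F)

variable {𝕜}

/-- The class `Space(I)` of all Banach spaces whose identity operator belongs to `I`. -/
def spaceClass (I : OperatorClass.{u} 𝕜) : Set (Ban.{u} 𝕜) :=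
  {E | ContinuousLinearMap.id 𝕜 E ∈ I E E}

/-- The class `Op(C)` of all operators that factor continuously and linearly through a member of
the class of Banach spaces `C`. -/
def opClass (C : Set (Ban.{u} 𝕜)) : OperatorClass.{u} 𝕜 :=
  fun E F => {T | ∃ D ∈ C, ∃ (A : E →L[𝕜] D) (B : D →L[𝕜] F), T = B.comp A}

/-- `I` has the factorization property: `I ⊆ Op(Space(I))`. -/
def HasFactorizationProperty (I : OperatorClass.{u} 𝕜) : Prop :=
  ∀ E F : Ban.{u} 𝕜, I E F ⊆ opClass (spaceClass I) E F

variable (𝕜)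

/-- The class of Banach spaces whose Szlenk index is at most `ω^α`. -/
def Szl (α : Ordinal.{u}) : Set (Ban.{u} 𝕜) :=
  {E | szlenkIndex (Metric.closedBall (0 : StrongDual 𝕜 E) 1) ⊆ Set.Iio (Ordinal.omega0 ^ α)}

/-- The class of `α`-Szlenk operators: those whose Szlenk index, that is the Szlenk index of
`T* B`, is at most `ω^α`. -/
def SzlenkOp (α : Ordinal.{u}) : OperatorClass.{u} 𝕜 :=
  fun _ _ => {T | szlenkIndex (adjointImageBall T) ⊆ Set.Iio (Ordinal.omega0 ^ α)}

/-- The Banach spaces `E`, with closed dual unit ball `B`, for which there are `c ∈ (0, 1)` and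
`p ≥ 1` with `s_ε^{ω^α}(B) ⊆ (1 - c ε^p) B` for all `ε ∈ (0, 1)`. -/
def PzlZero (α : Ordinal.{u}) : Set (Ban.{u} 𝕜) :=
  {E | ∃ c ∈ Set.Ioo (0 : ℝ) 1, ∃ p : ℝ, 1 ≤ p ∧ ∀ ε ∈ Set.Ioo (0 : ℝ) 1,
    szlenkIter ε (Metric.closedBall (0 : StrongDual 𝕜 E) 1) (Ordinal.omega0 ^ α) ⊆
      Metric.closedBall (0 : StrongDual 𝕜 E) (1 - c * ε ^ p)}

/-- The Banach spaces linearly isomorphic (linearly homeomorphic) to a member of `PzlZero 𝕜 α`. -/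
def Pzl (α : Ordinal.{u}) : Set (Ban.{u} 𝕜) :=
  {E | ∃ F ∈ PzlZero 𝕜 α, Nonempty (E ≃L[𝕜] F)}

end Classes

/-! The obstruction is a growth rate. If both statements held, every operator of Szlenk index at
most `ω ^ (α + 1)` would factor through a space with a power type estimate `s_ε^{ω^α}(B) ⊆ (1 - c
ε^p) B`. Iterating this shrinks the ball geometrically, so the `ε`-Szlenk index of the operator
would be at most `ω ^ α` times a quantity polynomial in `1 / ε` (`exists_szlenkIter_eq_empty`).

An operator `ℓ₁(S) → ℓ_∞(S)` violates this (`exists_szlenkOp_szlenkIter_nonempty`). Here `S` is a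
forest whose `n`-th tree has rank `ω ^ α * 2 ^ n + 1`, and the operator takes sums over initial
segments with weight `1 / (n + 1)`, so the index at scale about `1 / n` is exponential in `n`. Lower
bound: evaluation at a node is the weak-star limit of the evaluations at children of a given rank,
at distance at least the weight, so it survives as many derivations as its rank
(`pathEval_mem_szlenkIter`). Upper bound: the maximal coordinates where a functional exceeds `δ`
form an antichain of at most `1 / δ` nodes, and each derivation forces the natural sum of their
ranks to drop (`szlenkIter_pathSum_le`). Only finitely many trees have weight above `δ`, and natural
multiples of an ordinal below `ω ^ (α + 1)` stay below it. -/

open scoped ENNReal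

/-! ### Natural sums through Cantor normal form coefficients -/

namespace Ordinal

/-- The ordinal `ω ^ e₁ * n₁ + ⋯ + ω ^ eₖ * nₖ`, `e₁ > ⋯ > eₖ`, whose Cantor normal form has the
given coefficients. The addition of coefficients is the natural (Hessenberg) sum of ordinals. -/
noncomputable def ofCoeff (f : Colex (Ordinal.{v} →₀ ℕ)) : Ordinal.{v} :=
  CNF.eval omega0 ((ofColex f).mapRange (fun n : ℕ => (n : Ordinal)) Nat.cast_zero)

theorem eval_filter_add (F : Ordinal.{v} →₀ Ordinal.{v}) (i : Ordinal.{v}) :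
    CNF.eval omega0 F = CNF.eval omega0 (F.filter (i < ·)) +
      (omega0 ^ i * F i + CNF.eval omega0 (F.filter (· < i))) := by
  have h : F = F.filter (i < ·) + (Finsupp.single i (F i) + F.filter (· < i)) := by
    ext e
    rcases lt_trichotomy e i with h | h | h
    · simp [h, h.ne, h.not_gt]
    · subst h; simp
    · simp [h, h.ne', h.not_gt]
  conv_lhs => rw [h]
  rw [CNF.eval_add, CNF.eval_single_add']
  · intro e he
    simp only [Finsupp.support_filter, Finset.mem_filter] at he
    exact he.2
  · intro e he e' he'
    simp only [Finsupp.support_filter, Finset.mem_filter] at he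
    refine le_trans ?_ he.2.le
    rcases Finset.mem_union.1 (Finsupp.support_add he') with h | h
    · exact (Finset.mem_singleton.1 (Finsupp.support_single_subset h)).le
    · simp only [Finsupp.support_filter, Finset.mem_filter] at h
      exact h.2.le

/-- The largest exponent `i` at which the coefficients differ decides: the terms above it agree, and
all terms below it add up to less than one unit `ω ^ i`. -/
theorem ofCoeff_strictMono : StrictMono ofCoeff.{v} := by
  intro f g hfg
  obtain ⟨i, hi, hlt⟩ := Finsupp.Colex.lt_iff.1 hfg
  unfold ofCoeff
  set F := (ofColex f).mapRange (fun n : ℕ => (n : Ordinal.{v})) Nat.cast_zero with hF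
  set G := (ofColex g).mapRange (fun n : ℕ => (n : Ordinal.{v})) Nat.cast_zero with hG
  have hFG : F.filter (i < ·) = G.filter (i < ·) := by
    ext e
    by_cases he : i < e
    · simp only [Finsupp.filter_apply, he, if_true, hF, hG, Finsupp.mapRange_apply]
      exact congrArg _ (hi e he)
    · simp [he]
  rw [eval_filter_add F i, eval_filter_add G i, hFG]
  gcongr
  have h1 : CNF.eval omega0 (F.filter (· < i)) < omega0 ^ i := by
    apply CNF.eval_lt
    · intro e
      rw [Finsupp.filter_apply]
      split_ifs
      · exact natCast_lt_omega0 _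
      · exact omega0_pos
    · intro e he
      simp only [Finsupp.support_filter, Finset.mem_filter] at he
      exact he.2
  calc omega0 ^ i * F i + CNF.eval omega0 (F.filter (· < i))
      < omega0 ^ i * F i + omega0 ^ i := by gcongr
    _ = omega0 ^ i * (F i + 1) := by rw [mul_add, mul_one]
    _ ≤ omega0 ^ i * G i := by
        gcongr
        rw [Order.add_one_le_iff, hF, hG]
        simp only [Finsupp.mapRange_apply]
        exact Nat.cast_lt.2 hlt
    _ ≤ _ := le_self_add

theorem exists_ofCoeff_eq (o : Ordinal.{v}) : ∃ f, ofCoeff f = o ∧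
    ∀ e, o < omega0 ^ e → ∀ e' ≥ e, ofColex f e' = 0 := by
  have hlt (e) : CNF.coeff omega0 o e < omega0 := by
    by_cases he : e ∈ (CNF omega0 o).map Prod.fst
    · obtain ⟨⟨e', c⟩, hc, rfl⟩ := List.mem_map.1 he
      rw [CNF.coeff_of_mem_CNF hc]
      exact CNF.snd_lt one_lt_omega0 hc
    · rw [CNF.coeff_of_notMem_CNF he]
      exact omega0_pos
  choose n hn using fun e => lt_omega0.1 (hlt e)
  let f : Ordinal →₀ ℕ := Finsupp.onFinset (CNF.coeff omega0 o).support n (by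
    intro e he
    rw [Finsupp.mem_support_iff, hn]
    exact_mod_cast he)
  refine ⟨toColex f, ?_, fun e he e' he' => ?_⟩
  · have : f.mapRange (fun n : ℕ => (n : Ordinal)) Nat.cast_zero = CNF.coeff omega0 o := by
      ext e
      simp [f, hn]
    unfold ofCoeff
    rw [ofColex_toColex, this, CNF.eval_coeff]
  · have h : CNF.coeff omega0 o e' = 0 := CNF.coeff_eq_zero_of_lt
      (he.trans_le (opow_le_opow_right omega0_pos he'))
    rw [hn] at h
    exact_mod_cast h

theorem ofCoeff_lt {f : Colex (Ordinal.{v} →₀ ℕ)} {e : Ordinal.{v}}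
    (h : ∀ e' ≥ e, ofColex f e' = 0) : ofCoeff f < omega0 ^ e := by
  apply CNF.eval_lt
  · intro e
    exact natCast_lt_omega0 _
  · intro e' he'
    by_contra! hle
    simp [h e' hle] at he'

/-- The coefficients of the Cantor normal form of an ordinal. -/
noncomputable def toCoeff (o : Ordinal.{v}) : Colex (Ordinal.{v} →₀ ℕ) :=
  (exists_ofCoeff_eq o).choose

theorem ofCoeff_toCoeff (o : Ordinal.{v}) : ofCoeff (toCoeff o) = o :=
  (exists_ofCoeff_eq o).choose_spec.1

theorem toCoeff_strictMono : StrictMono toCoeff.{v} := fun a b h => by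
  rwa [← ofCoeff_strictMono.lt_iff_lt, ofCoeff_toCoeff, ofCoeff_toCoeff]

theorem ofCoeff_nsmul_toCoeff_lt {o e : Ordinal.{v}} (h : o < omega0 ^ e) (n : ℕ) :
    ofCoeff (n • toCoeff o) < omega0 ^ e := by
  apply ofCoeff_lt
  intro e' he'
  have := (exists_ofCoeff_eq o).choose_spec.2 e h e' he'
  change n • (ofColex (toCoeff o) e') = 0
  rw [toCoeff, this, smul_zero]

end Ordinal

/-! ### Rank sums of antichains in a forest -/

/-- Enlarging an antichain `M` with at most `N` elements in a forest to an antichain `M'` that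
dominates `M` and is not dominated by it decreases the sum of the ranks, padded to `N` terms. -/
theorem sum_rank_lt_sum_rank {S Γ : Type*} [PartialOrder S] [AddCommMonoid Γ] [PartialOrder Γ]
    [IsOrderedCancelAddMonoid Γ] {ρ : S → Γ} (hρ : StrictAnti ρ)
    (htree : ∀ a b c : S, a ≤ c → b ≤ c → a ≤ b ∨ b ≤ a)
    {M M' : Finset S} (hM : IsAntichain (· ≤ ·) (M : Set S)) {N : ℕ} (hN : M'.card ≤ N) {θ : Γ}
    (hθ : ∀ m ∈ M', ρ m < θ) (hdom : ∀ m ∈ M, ∃ m' ∈ M', m ≤ m')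
    {t : S} (ht : t ∈ M') (htM : ∀ m ∈ M, ¬ t ≤ m) :
    ∑ m ∈ M', ρ m + (N - M'.card) • θ < ∑ m ∈ M, ρ m + (N - M.card) • θ := by
  classical
  choose! i hi hle using hdom
  -- Two nodes below a common node of a forest are comparable, which the antichain `M` forbids.
  have hinj : Set.InjOn i M := fun a ha b hb hab => by
    by_contra hne
    rcases htree a b (i a) (hle a ha) (hab ▸ hle b hb) with h | h
    · exact hM ha hb hne h
    · exact hM hb ha (Ne.symm hne) h
  have hsub : M.image i ⊆ M' := Finset.image_subset_iff.2 hi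
  have hcard : (M.image i).card = M.card := Finset.card_image_of_injOn hinj
  have hcardle := Finset.card_le_card hsub
  have hsplit : ∑ m ∈ M', ρ m = ∑ m ∈ M, ρ (i m) + ∑ m ∈ M' \ M.image i, ρ m := by
    rw [← Finset.sum_image (f := ρ) hinj, add_comm, Finset.sum_sdiff hsub]
  have hpad : (N - M.card) • θ = (M' \ M.image i).card • θ + (N - M'.card) • θ := by
    rw [← add_nsmul, Finset.card_sdiff_of_subset hsub, hcard]
    congr 1
    omega
  rw [hsplit, hpad, ← add_assoc]
  apply add_lt_add_left
  have h1 : ∑ m ∈ M, ρ (i m) ≤ ∑ m ∈ M, ρ m :=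
    Finset.sum_le_sum fun m hm => hρ.antitone (hle m hm)
  have h2 : ∑ m ∈ M' \ M.image i, ρ m ≤ (M' \ M.image i).card • θ :=
    Finset.sum_le_card_nsmul _ _ _ fun m hm => (hθ m (Finset.mem_sdiff.1 hm).1).le
  -- Either `t` strictly dominates some node of `M`, and that rank drops, or `t` occupies a padding
  -- slot and replaces `θ` by a smaller rank.
  by_cases h : t ∈ M.image i
  · obtain ⟨m, hm, rfl⟩ := Finset.mem_image.1 h
    refine add_lt_add_of_lt_of_le (Finset.sum_lt_sum (fun m hm => hρ.antitone (hle m hm)) ?_) h2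
    exact ⟨m, hm, hρ ((hle m hm).lt_of_not_ge (htM m hm))⟩
  · refine add_lt_add_of_le_of_lt h1 ?_
    rw [← Finset.sum_const]
    exact Finset.sum_lt_sum (fun m hm => (hθ m (Finset.mem_sdiff.1 hm).1).le)
      ⟨t, Finset.mem_sdiff.2 ⟨ht, h⟩, hθ t ht⟩

/-! ### Calculus of Szlenk derivations -/

section SzlenkIter

variable {𝕜 : Type} [RCLike 𝕜]
variable {E : Type u} [NormedAddCommGroup E] [NormedSpace 𝕜 E]
variable {F : Type u} [NormedAddCommGroup F] [NormedSpace 𝕜 F]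

theorem szlenkIter_zero (ε : ℝ) (K : Set (StrongDual 𝕜 E)) :
    szlenkIter ε K (0 : Ordinal.{v}) = K :=
  Ordinal.limitRecOn_zero ..

theorem szlenkIter_add_one (ε : ℝ) (K : Set (StrongDual 𝕜 E)) (γ : Ordinal.{v}) :
    szlenkIter ε K (γ + 1) = szlenkDerivation ε (szlenkIter ε K γ) :=
  Ordinal.limitRecOn_add_one ..

theorem szlenkIter_limit (ε : ℝ) (K : Set (StrongDual 𝕜 E)) {γ : Ordinal.{v}}
    (hγ : Order.IsSuccLimit γ) : szlenkIter ε K γ = ⋂ β < γ, szlenkIter ε K β :=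
  Ordinal.limitRecOn_limit _ _ _ _ hγ

theorem szlenkDerivation_subset (ε : ℝ) (K : Set (StrongDual 𝕜 E)) :
    szlenkDerivation ε K ⊆ K := fun _ h => h.1

theorem szlenkDerivation_mono {ε ε' : ℝ} (hε : ε ≤ ε') {K L : Set (StrongDual 𝕜 E)}
    (h : K ⊆ L) : szlenkDerivation ε' K ⊆ szlenkDerivation ε L := fun _ hx =>
  ⟨h hx.1, fun V hV hxV => (ENNReal.ofReal_le_ofReal hε).trans_lt <|
    (hx.2 V hV hxV).trans_le (Metric.ediam_mono (Set.inter_subset_inter_left _ h))⟩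

theorem szlenkIter_mono {ε : ℝ} {K L : Set (StrongDual 𝕜 E)}
    (h : K ⊆ L) (γ : Ordinal.{v}) : szlenkIter ε K γ ⊆ szlenkIter ε L γ := by
  induction γ using Ordinal.limitRecOn with
  | zero => simpa only [szlenkIter_zero]
  | add_one γ ih =>
    simp only [szlenkIter_add_one]
    exact szlenkDerivation_mono le_rfl ih
  | limit γ hγ ih =>
    simp only [szlenkIter_limit _ _ hγ]
    exact Set.iInter₂_mono ih

theorem szlenkIter_subset (ε : ℝ) (K : Set (StrongDual 𝕜 E)) (γ : Ordinal.{v}) :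
    szlenkIter ε K γ ⊆ K := by
  induction γ using Ordinal.limitRecOn with
  | zero => rw [szlenkIter_zero]
  | add_one γ ih =>
    rw [szlenkIter_add_one]
    exact (szlenkDerivation_subset _ _).trans ih
  | limit γ hγ ih =>
    rw [szlenkIter_limit _ _ hγ]
    exact (Set.iInter₂_subset 0 hγ.bot_lt).trans (ih 0 hγ.bot_lt)

theorem szlenkIter_antitone (ε : ℝ) (K : Set (StrongDual 𝕜 E)) :
    Antitone (szlenkIter ε K : Ordinal.{v} → _) := by
  intro β γ h
  induction γ using Ordinal.limitRecOn with
  | zero => rw [nonpos_iff_eq_zero.1 h]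
  | add_one γ ih =>
    rcases h.eq_or_lt with rfl | h
    · rfl
    rw [szlenkIter_add_one]
    exact (szlenkDerivation_subset _ _).trans (ih (Order.lt_add_one_iff.1 h))
  | limit γ hγ ih =>
    rcases h.eq_or_lt with rfl | h
    · rfl
    rw [szlenkIter_limit _ _ hγ]
    exact Set.iInter₂_subset β h

theorem szlenkIter_add_subset (ε : ℝ) (K : Set (StrongDual 𝕜 E)) (β γ : Ordinal.{v}) :
    szlenkIter ε K (β + γ) ⊆ szlenkIter ε (szlenkIter ε K β) γ := by
  induction γ using Ordinal.limitRecOn with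
  | zero => rw [add_zero, szlenkIter_zero]
  | add_one γ ih =>
    rw [← add_assoc, szlenkIter_add_one, szlenkIter_add_one]
    exact szlenkDerivation_mono le_rfl ih
  | limit γ hγ ih =>
    rw [szlenkIter_limit _ _ hγ, szlenkIter_limit _ _ (Ordinal.isSuccLimit_add β hγ)]
    exact Set.subset_iInter₂ fun δ hδ =>
      (Set.iInter₂_subset (β + δ) (by gcongr)).trans (ih δ hδ)

theorem szlenkDerivation_eq_empty_of_subset_closedBall {ε r : ℝ} {K : Set (StrongDual 𝕜 E)}
    (h : K ⊆ Metric.closedBall 0 r) (hr : 2 * r ≤ ε) : szlenkDerivation ε K = ∅ := by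
  refine Set.eq_empty_of_forall_notMem fun x hx => ?_
  refine (hx.2 Set.univ isOpen_univ trivial).not_ge (Metric.ediam_le fun y hy z hz => ?_)
  rw [edist_dist]
  apply ENNReal.ofReal_le_ofReal
  have h1 := Metric.mem_closedBall.1 (h hy.1)
  have h2 := Metric.mem_closedBall.1 (h hz.1)
  linarith [dist_triangle_right y z 0]

theorem exists_dist_gt_of_lt_ediam {X : Type*} [PseudoMetricSpace X] {K : Set X} {ε : ℝ}
    (h : ENNReal.ofReal ε < Metric.ediam K) : ∃ y ∈ K, ∃ z ∈ K, ε < dist y z := by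
  by_contra! hc
  refine h.not_ge (Metric.ediam_le fun y hy z hz => ?_)
  rw [edist_dist]
  exact ENNReal.ofReal_le_ofReal (hc y hy z hz)

theorem lt_ediam_of_dist_gt {X : Type*} [PseudoMetricSpace X] {K : Set X} {ε : ℝ}
    (hε : 0 ≤ ε) {y z : X} (hy : y ∈ K) (hz : z ∈ K) (h : ε < dist y z) :
    ENNReal.ofReal ε < Metric.ediam K := by
  refine lt_of_lt_of_le ?_ (Metric.edist_le_ediam_of_mem hy hz)
  rw [edist_dist]
  exact (ENNReal.ofReal_lt_ofReal_iff (hε.trans_lt h)).2 h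

/-- If the multiplication by `a ≥ 1` maps `K` into `L`, then it maps `s_ε^γ(K)` into
`s_ε^γ(L)`. -/
theorem smul_mem_szlenkIter {ε : ℝ} (hε : 0 ≤ ε) {K L : Set (StrongDual 𝕜 E)} {a : ℝ}
    (ha : 1 ≤ a) (hKL : ∀ x ∈ K, (a : 𝕜) • x ∈ L) (γ : Ordinal.{v}) :
    ∀ x ∈ szlenkIter ε K γ, (a : 𝕜) • x ∈ szlenkIter ε L γ := by
  induction γ using Ordinal.limitRecOn with
  | zero => simpa only [szlenkIter_zero]
  | add_one γ ih =>
    intro x hx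
    simp only [szlenkIter_add_one] at hx ⊢
    refine ⟨ih x hx.1, fun V hV hxV => ?_⟩
    have hcont : Continuous fun y : WeakDual 𝕜 E => (a : 𝕜) • y := continuous_const_smul _
    obtain ⟨y, hy, z, hz, hyz⟩ := exists_dist_gt_of_lt_ediam
      (hx.2 _ (hV.preimage hcont) (by simpa using hxV))
    refine lt_ediam_of_dist_gt hε (y := (a : 𝕜) • y) (z := (a : 𝕜) • z)
      ⟨ih y hy.1, by simpa using hy.2⟩ ⟨ih z hz.1, by simpa using hz.2⟩ ?_
    rw [dist_eq_norm] at hyz ⊢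
    rw [show (a : 𝕜) • y - (a : 𝕜) • z = (a : 𝕜) • (y - z) from (smul_sub _ _ _).symm,
      norm_smul, RCLike.norm_ofReal, abs_of_nonneg (zero_le_one.trans ha)]
    nlinarith [norm_nonneg (y - z)]
  | limit γ hγ ih =>
    intro x hx
    simp only [szlenkIter_limit _ _ hγ, Set.mem_iInter] at hx ⊢
    exact fun β hβ => ih β hβ x (hx β hβ)

theorem isClosed_toWeakDual_image_szlenkDerivation (ε : ℝ) {K : Set (StrongDual 𝕜 E)}
    (hK : IsClosed (StrongDual.toWeakDual '' K)) :
    IsClosed (StrongDual.toWeakDual '' szlenkDerivation ε K) := by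
  refine isClosed_of_closure_subset fun x hx => ?_
  obtain ⟨x, rfl⟩ := StrongDual.toWeakDual.surjective x
  refine ⟨x, ⟨?_, fun V hV hxV => ?_⟩, rfl⟩
  · have := hK.closure_subset_iff.2 (Set.image_mono (szlenkDerivation_subset ε K)) hx
    rwa [StrongDual.toWeakDual.injective.mem_set_image] at this
  · obtain ⟨_, hyV, y, hy, rfl⟩ := mem_closure_iff.1 hx V hV hxV
    exact hy.2 V hV hyV

theorem isClosed_toWeakDual_image_szlenkIter (ε : ℝ) {K : Set (StrongDual 𝕜 E)}
    (hK : IsClosed (StrongDual.toWeakDual '' K)) (γ : Ordinal.{v}) :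
    IsClosed (StrongDual.toWeakDual '' szlenkIter ε K γ) := by
  induction γ using Ordinal.limitRecOn with
  | zero => rwa [szlenkIter_zero]
  | add_one γ ih =>
    rw [szlenkIter_add_one]
    exact isClosed_toWeakDual_image_szlenkDerivation ε ih
  | limit γ hγ ih =>
    rw [szlenkIter_limit _ _ hγ, Set.image_iInter₂ StrongDual.toWeakDual.bijective]
    exact isClosed_iInter fun β => isClosed_iInter fun hβ => ih β hβ

/-- The adjoint of a bounded operator, between the weak-star topologies. -/
theorem continuous_weakDual_comp (A : E →L[𝕜] F) :
    Continuous fun φ : WeakDual 𝕜 F =>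
      StrongDual.toWeakDual ((WeakDual.toStrongDual φ).comp A) :=
  WeakDual.continuous_of_continuous_eval fun y => WeakDual.eval_continuous (A y)

/-- If no preimage of `x` survives, neighbourhoods of diameter at most `ε'` cover the fibre over
`x`. By compactness the image of the rest of `L` is closed and misses `x`, so near `x` every point
of the image lies within `‖A‖ * ε'` of `x`. The triangle inequality through `x` accounts for the
factor 2. -/
theorem szlenkDerivation_comp_image_subset (A : E →L[𝕜] F) {ε ε' : ℝ} (hε' : 0 ≤ ε')
    (h : 2 * ‖A‖ * ε' ≤ ε) {L : Set (StrongDual 𝕜 F)}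
    (hL : IsCompact (StrongDual.toWeakDual '' L)) :
    szlenkDerivation ε ((fun φ : StrongDual 𝕜 F => φ.comp A) '' L) ⊆
      (fun φ : StrongDual 𝕜 F => φ.comp A) '' szlenkDerivation ε' L := by
  intro x hx
  by_contra hcon
  have key : ∀ z ∈ L, z.comp A = x → ∃ V : Set (WeakDual 𝕜 F), IsOpen V ∧
      StrongDual.toWeakDual z ∈ V ∧
      Metric.ediam (L ∩ StrongDual.toWeakDual ⁻¹' V) ≤ ENNReal.ofReal ε' := by
    intro z hz hzx
    by_contra! hV
    exact hcon ⟨z, ⟨hz, hV⟩, hzx⟩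
  choose! V hVo hzV hV using key
  set U : Set (WeakDual 𝕜 F) := ⋃ z ∈ {z | z ∈ L ∧ z.comp A = x}, V z with hU
  have hUo : IsOpen U := isOpen_biUnion fun z hz => hVo z hz.1 hz.2
  set C := (fun φ : WeakDual 𝕜 F => StrongDual.toWeakDual ((WeakDual.toStrongDual φ).comp A)) ''
    (StrongDual.toWeakDual '' L \ U) with hC
  have hCc : IsClosed C := ((hL.diff hUo).image (continuous_weakDual_comp A)).isClosed
  have hxC : StrongDual.toWeakDual x ∉ C := by
    rintro ⟨_, ⟨⟨z, hz, rfl⟩, hzU⟩, hzx⟩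
    have hzx' : z.comp A = x := StrongDual.toWeakDual.injective hzx
    exact hzU (Set.mem_biUnion (show z ∈ {z | z ∈ L ∧ z.comp A = x} from ⟨hz, hzx'⟩)
      (hzV z hz hzx'))
  have hclose : ∀ y ∈ (fun φ : StrongDual 𝕜 F => φ.comp A) '' L ∩ StrongDual.toWeakDual ⁻¹' Cᶜ,
      dist y x ≤ ‖A‖ * ε' := by
    rintro _ ⟨⟨y, hy, rfl⟩, hyC⟩
    have hyU : StrongDual.toWeakDual y ∈ U := by
      by_contra hyU
      exact hyC ⟨_, ⟨⟨y, hy, rfl⟩, hyU⟩, rfl⟩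
    obtain ⟨z, ⟨hz, hzx⟩, hyV⟩ := Set.mem_iUnion₂.1 hyU
    have hd : dist y z ≤ ε' := by
      have := (Metric.edist_le_ediam_of_mem (s := L ∩ StrongDual.toWeakDual ⁻¹' V z)
        ⟨hy, hyV⟩ ⟨hz, hzV z hz hzx⟩).trans (hV z hz hzx)
      rw [edist_dist] at this
      exact (ENNReal.ofReal_le_ofReal_iff hε').1 this
    rw [dist_eq_norm] at hd ⊢
    calc ‖y.comp A - x‖ = ‖(y - z).comp A‖ := by rw [← hzx, ContinuousLinearMap.sub_comp]
      _ ≤ ‖y - z‖ * ‖A‖ := ContinuousLinearMap.opNorm_comp_le _ _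
      _ ≤ ‖A‖ * ε' := by rw [mul_comm]; gcongr
  refine (hx.2 Cᶜ hCc.isOpen_compl hxC).not_ge (Metric.ediam_le fun y hy z hz => ?_)
  rw [edist_dist]
  apply ENNReal.ofReal_le_ofReal
  linarith [dist_triangle_right y z x, hclose y hy, hclose z hz]

theorem szlenkIter_comp_image_subset (A : E →L[𝕜] F) {ε ε' : ℝ} (hε' : 0 ≤ ε')
    (h : 2 * ‖A‖ * ε' ≤ ε) {K : Set (StrongDual 𝕜 F)}
    (hK : IsCompact (StrongDual.toWeakDual '' K)) (γ : Ordinal.{v}) :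
    szlenkIter ε ((fun φ : StrongDual 𝕜 F => φ.comp A) '' K) γ ⊆
      (fun φ : StrongDual 𝕜 F => φ.comp A) '' szlenkIter ε' K γ := by
  have hcomp (β : Ordinal.{v}) : IsCompact (StrongDual.toWeakDual '' szlenkIter ε' K β) :=
    hK.of_isClosed_subset (isClosed_toWeakDual_image_szlenkIter ε' hK.isClosed β)
      (Set.image_mono (szlenkIter_subset _ _ _))
  induction γ using Ordinal.limitRecOn with
  | zero => simp only [szlenkIter_zero]; rfl
  | add_one γ ih =>
    simp only [szlenkIter_add_one]
    exact (szlenkDerivation_mono le_rfl ih).trans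
      (szlenkDerivation_comp_image_subset A hε' h (hcomp γ))
  | limit γ hγ ih =>
    intro x hx
    simp only [szlenkIter_limit _ _ hγ, Set.mem_iInter] at hx
    have hfib : IsClosed {φ : WeakDual 𝕜 F | StrongDual.toWeakDual
        ((WeakDual.toStrongDual φ).comp A) = StrongDual.toWeakDual x} :=
      isClosed_eq (continuous_weakDual_comp A) continuous_const
    -- A single preimage of `x` must serve all stages `β < γ`: the traces of the stages on the fibre
    -- are nonempty, compact and decreasing.
    set Z : Set.Iio γ → Set (WeakDual 𝕜 F) := fun β =>
      StrongDual.toWeakDual '' szlenkIter ε' K β.1 ∩ {φ : WeakDual 𝕜 F | StrongDual.toWeakDual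
        ((WeakDual.toStrongDual φ).comp A) = StrongDual.toWeakDual x} with hZ
    have : Nonempty (Set.Iio γ) := ⟨⟨0, hγ.bot_lt⟩⟩
    have hne : (⋂ β, Z β).Nonempty := by
      refine IsCompact.nonempty_iInter_of_directed_nonempty_isCompact_isClosed Z ?_ ?_ ?_ ?_
      · refine Antitone.directed_ge fun β δ hβδ => ?_
        exact Set.inter_subset_inter_left _ (Set.image_mono (szlenkIter_antitone ε' K hβδ))
      · intro β
        obtain ⟨z, hz, hzx⟩ := ih β.1 β.2 (hx β.1 β.2)
        exact ⟨StrongDual.toWeakDual z, ⟨z, hz, rfl⟩, congrArg StrongDual.toWeakDual hzx⟩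
      · exact fun β => (hcomp β.1).inter_right hfib
      · exact fun β => (hcomp β.1).isClosed.inter hfib
    obtain ⟨z, hz⟩ := hne
    rw [Set.mem_iInter] at hz
    refine ⟨WeakDual.toStrongDual z, ?_, StrongDual.toWeakDual.injective (hz ⟨0, hγ.bot_lt⟩).2⟩
    rw [szlenkIter_limit _ _ hγ]
    simp only [Set.mem_iInter]
    intro β hβ
    obtain ⟨z', hz', hzz⟩ := (hz ⟨β, hβ⟩).1
    rw [← hzz]
    exact hz'

theorem isCompact_toWeakDual_image_closedBall (r : ℝ) :
    IsCompact (StrongDual.toWeakDual '' Metric.closedBall (0 : StrongDual 𝕜 E) r) := by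
  convert WeakDual.isCompact_closedBall (𝕜 := 𝕜) (E := E) 0 r using 1
  ext x
  constructor
  · rintro ⟨y, hy, rfl⟩
    exact hy
  · exact fun hx => ⟨WeakDual.toStrongDual x, hx, rfl⟩

/-- Iterating `s_ε^γ(B) ⊆ q B`, `B` the dual unit ball. -/
theorem szlenkIter_mul_natCast_subset {ε q : ℝ} (hε : 0 ≤ ε) (hq : 0 < q) (hq1 : q ≤ 1)
    {γ : Ordinal.{v}} (h : szlenkIter ε (Metric.closedBall (0 : StrongDual 𝕜 E) 1) γ ⊆
      Metric.closedBall 0 q) (n : ℕ) :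
    szlenkIter ε (Metric.closedBall (0 : StrongDual 𝕜 E) 1) (γ * n) ⊆
      Metric.closedBall 0 (q ^ n) := by
  induction n with
  | zero => simp [szlenkIter_zero]
  | succ n ih =>
    rw [Nat.cast_succ, mul_add, mul_one]
    refine (szlenkIter_add_subset _ _ _ _).trans ((szlenkIter_mono ih γ).trans fun x hx => ?_)
    have hqn : 0 < q ^ n := by positivity
    -- Rescaling the ball of radius `q ^ n` to the unit ball expands distances, so the same `ε` can
    -- be kept.
    have := h (smul_mem_szlenkIter hε (a := (q ^ n)⁻¹)
      (L := Metric.closedBall (0 : StrongDual 𝕜 E) 1)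
      ((one_le_inv₀ hqn).2 (pow_le_one₀ hq.le hq1)) (fun y hy => ?_) γ x hx)
    · rw [mem_closedBall_zero_iff, norm_smul, RCLike.norm_ofReal,
        abs_of_pos (inv_pos.2 hqn)] at this
      rw [mem_closedBall_zero_iff, pow_succ]
      rwa [inv_mul_le_iff₀ hqn] at this
    · rw [mem_closedBall_zero_iff] at hy
      rw [mem_closedBall_zero_iff, norm_smul, RCLike.norm_ofReal, abs_of_pos (inv_pos.2 hqn)]
      rwa [inv_mul_le_iff₀ hqn, mul_one]

end SzlenkIter

/-! ### The weighted path-sum operator on a forest -/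

section PathSum

variable {𝕜 : Type} [RCLike 𝕜] {S : Type u}

theorem lp_one_hasSum_norm (x : lp (fun _ : S => 𝕜) 1) : HasSum (fun s => ‖x s‖) ‖x‖ := by
  simpa using lp.hasSum_norm (p := 1) (by simp) x

theorem lp_one_sum_norm_le (x : lp (fun _ : S => 𝕜) 1) (A : Finset S) :
    ∑ s ∈ A, ‖x s‖ ≤ ‖x‖ :=
  sum_le_hasSum A (fun _ _ => norm_nonneg _) (lp_one_hasSum_norm x)

/-- The unit vectors of `ℓ₁(S)`. -/
noncomputable def unitVec (𝕜 : Type) [RCLike 𝕜] {S : Type u} (s : S) : lp (fun _ : S => 𝕜) 1 :=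
  open Classical in lp.single 1 s (1 : 𝕜)

theorem unitVec_self (s : S) : unitVec 𝕜 s s = 1 := by
  simp [unitVec]

theorem unitVec_of_ne {s t : S} (h : t ≠ s) : unitVec 𝕜 s t = 0 := by
  classical
  simp [unitVec, h]

theorem lp_one_dual_norm_le (φ : StrongDual 𝕜 (lp (fun _ : S => 𝕜) 1)) {C : ℝ} (hC : 0 ≤ C)
    (h : ∀ s, ‖φ (unitVec 𝕜 s)‖ ≤ C) : ‖φ‖ ≤ C := by
  classical
  refine φ.opNorm_le_bound hC fun x => ?_
  have h1 : HasSum (fun s => φ (lp.single 1 s (x s))) (φ x) :=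
    (lp.hasSum_single (by simp) x).mapL φ
  refine h1.norm_le_of_bounded ((lp_one_hasSum_norm x).mul_left C) fun s => ?_
  have : lp.single 1 s (x s) = x s • unitVec 𝕜 s := by
    unfold unitVec
    rw [← lp.single_smul]
    simp
  rw [this, map_smul, smul_eq_mul, norm_mul, mul_comm]
  gcongr
  exact h s

variable [PartialOrder S] [LocallyFiniteOrderBot S]

/-- The operator `ℓ₁(S) → ℓ_∞(S)` taking `x` to the family of its weighted sums
`w p * ∑ s ≤ p, x s` over initial segments. -/
noncomputable def pathSum (𝕜 : Type) [RCLike 𝕜] (w : S → ℝ) (hw : ∀ p, ‖w p‖ ≤ 1) :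
    lp (fun _ : S => 𝕜) 1 →L[𝕜] lp (fun _ : S => 𝕜) ∞ :=
  have hb (x : lp (fun _ : S => 𝕜) 1) (p : S) :
      ‖(w p : 𝕜) * ∑ s ∈ Finset.Iic p, x s‖ ≤ ‖x‖ := by
    rw [norm_mul, RCLike.norm_ofReal, ← Real.norm_eq_abs]
    have := (norm_sum_le _ _).trans (lp_one_sum_norm_le x (Finset.Iic p))
    nlinarith [hw p, norm_nonneg (w p), norm_nonneg (∑ s ∈ Finset.Iic p, x s)]
  LinearMap.mkContinuous
    { toFun := fun x => ⟨fun p => (w p : 𝕜) * ∑ s ∈ Finset.Iic p, x s,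
        memℓp_infty ⟨‖x‖, by rintro _ ⟨p, rfl⟩; exact hb x p⟩⟩
      map_add' := fun x y => by
        ext p
        change (w p : 𝕜) * ∑ s ∈ Finset.Iic p, (x s + y s) = (w p : 𝕜) * ∑ s ∈ Finset.Iic p, x s +
          (w p : 𝕜) * ∑ s ∈ Finset.Iic p, y s
        rw [Finset.sum_add_distrib, mul_add]
      map_smul' := fun c x => by
        ext p
        simp [← Finset.mul_sum, mul_left_comm] } 1
    fun x => by
      rw [one_mul]
      exact lp.norm_le_of_forall_le (norm_nonneg _) fun p => hb x p

theorem pathSum_apply (w : S → ℝ) (hw : ∀ p, ‖w p‖ ≤ 1) (x : lp (fun _ : S => 𝕜) 1) (p : S) :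
    pathSum 𝕜 w hw x p = (w p : 𝕜) * ∑ s ∈ Finset.Iic p, x s := rfl

theorem exists_norm_le_one_mul_eq_norm (z : 𝕜) : ∃ a : 𝕜, ‖a‖ ≤ 1 ∧ a * z = (‖z‖ : 𝕜) := by
  by_cases hz : z = 0
  · exact ⟨0, by simp, by simp [hz]⟩
  have hz' : (‖z‖ : 𝕜) ≠ 0 := by simpa using hz
  refine ⟨starRingEnd 𝕜 z / ‖z‖, ?_, ?_⟩
  · rw [norm_div, RCLike.norm_conj, RCLike.norm_ofReal, abs_norm, div_self (by simpa using hz)]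
  · rw [div_mul_eq_mul_div, RCLike.conj_mul, sq, mul_div_cancel_right₀ _ hz']

/-- An initial segment of a forest is a chain and meets the antichain `A` at most once. Hence a
combination of the unit vectors of `A` with coefficients of modulus at most 1 has image of norm at
most `C`; choosing the coefficients to align the phases gives the sum. -/
theorem sum_norm_le_of_mem_adjointImageBall_pathSum {w : S → ℝ} {hw : ∀ p, ‖w p‖ ≤ 1}
    {φ : StrongDual 𝕜 (lp (fun _ : S => 𝕜) 1)} (hφ : φ ∈ adjointImageBall (pathSum 𝕜 w hw))
    {A : Finset S} (hA : IsAntichain (· ≤ ·) (A : Set S))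
    (htree : ∀ a b c : S, a ≤ c → b ≤ c → a ≤ b ∨ b ≤ a) {C : ℝ} (hC : 0 ≤ C)
    (hwC : ∀ p, (∃ s ∈ A, s ≤ p) → ‖w p‖ ≤ C) :
    ∑ s ∈ A, ‖φ (unitVec 𝕜 s)‖ ≤ C := by
  classical
  obtain ⟨ψ, hψ, rfl⟩ := hφ
  rw [mem_closedBall_zero_iff] at hψ
  set φ := ψ.comp (pathSum 𝕜 w hw) with hφ
  choose a ha hae using fun s => exists_norm_le_one_mul_eq_norm (φ (unitVec 𝕜 s))
  set x : lp (fun _ : S => 𝕜) 1 := ∑ s ∈ A, a s • unitVec 𝕜 s with hx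
  have hxs (t : S) : x t = if t ∈ A then a t else 0 := by
    rw [hx, lp.coeFn_sum, Finset.sum_apply]
    simp only [lp.coeFn_smul, Pi.smul_apply]
    split_ifs with ht
    · rw [Finset.sum_eq_single_of_mem t ht, unitVec_self, smul_eq_mul, mul_one]
      intro s _ hs
      rw [unitVec_of_ne hs.symm, smul_zero]
    · refine Finset.sum_eq_zero fun s hs => ?_
      rw [unitVec_of_ne (ne_of_mem_of_not_mem hs ht).symm, smul_zero]
  have hnorm : ‖pathSum 𝕜 w hw x‖ ≤ C := by
    refine lp.norm_le_of_forall_le hC fun p => ?_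
    rw [pathSum_apply, norm_mul, RCLike.norm_ofReal, ← Real.norm_eq_abs]
    simp only [hxs, ← Finset.sum_filter]
    by_cases hp : ∃ s ∈ A, s ≤ p
    · have hcard : ((Finset.Iic p).filter (· ∈ A)).card ≤ 1 := by
        refine Finset.card_le_one.2 fun s hs t ht => ?_
        simp only [Finset.mem_filter, Finset.mem_Iic] at hs ht
        by_contra hne
        rcases htree s t p hs.1 ht.1 with h | h
        · exact hA hs.2 ht.2 hne h
        · exact hA ht.2 hs.2 (Ne.symm hne) h
      have h1 : ‖∑ s ∈ Finset.Iic p with s ∈ A, a s‖ ≤ 1 := by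
        refine (norm_sum_le_of_le _ fun s _ => ha s).trans ?_
        simpa using hcard
      have := hwC p hp
      nlinarith [norm_nonneg (w p), norm_nonneg (∑ s ∈ Finset.Iic p with s ∈ A, a s)]
    · rw [Finset.filter_false_of_mem]
      · simpa using hC
      · exact fun s hs hsA => hp ⟨s, hsA, Finset.mem_Iic.1 hs⟩
  have hval : φ x = ((∑ s ∈ A, ‖φ (unitVec 𝕜 s)‖ : ℝ) : 𝕜) := by
    rw [hx, map_sum]
    simp [hae]
  calc ∑ s ∈ A, ‖φ (unitVec 𝕜 s)‖ = ‖φ x‖ := by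
        rw [hval, RCLike.norm_ofReal, abs_of_nonneg (Finset.sum_nonneg fun _ _ => norm_nonneg _)]
    _ ≤ ‖ψ‖ * ‖pathSum 𝕜 w hw x‖ := ψ.le_opNorm _
    _ ≤ C := by nlinarith [norm_nonneg (pathSum 𝕜 w hw x), norm_nonneg ψ]

theorem norm_apply_unitVec_le_of_mem_adjointImageBall_pathSum {w : S → ℝ} {hw : ∀ p, ‖w p‖ ≤ 1}
    {φ : StrongDual 𝕜 (lp (fun _ : S => 𝕜) 1)} (hφ : φ ∈ adjointImageBall (pathSum 𝕜 w hw))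
    (htree : ∀ a b c : S, a ≤ c → b ≤ c → a ≤ b ∨ b ≤ a)
    (hwmono : ∀ s p : S, s ≤ p → w p = w s) (m : S) : ‖φ (unitVec 𝕜 m)‖ ≤ ‖w m‖ := by
  have := sum_norm_le_of_mem_adjointImageBall_pathSum hφ (A := {m}) (by simp) htree
    (norm_nonneg (w m)) fun p ⟨s, hs, hsp⟩ => by
      rw [Finset.mem_singleton] at hs
      rw [hwmono m p (hs ▸ hsp)]
  rwa [Finset.sum_singleton] at this

end PathSum

/-! ### Upper bound for the Szlenk index -/

section UpperBound

variable {𝕜 : Type} [RCLike 𝕜] {S : Type u} [PartialOrder S]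

/-- The maximal elements of the set of coordinates at which `φ` is larger than `δ`. -/
def maxCoords (δ : ℝ) (φ : StrongDual 𝕜 (lp (fun _ : S => 𝕜) 1)) : Set S :=
  {m | Maximal (fun s => δ < ‖φ (unitVec 𝕜 s)‖) m}

theorem isAntichain_maxCoords (δ : ℝ) (φ : StrongDual 𝕜 (lp (fun _ : S => 𝕜) 1)) :
    IsAntichain (· ≤ ·) (maxCoords δ φ) :=
  setOfPred_maximal_antichain _

theorem lt_of_mem_maxCoords {δ : ℝ} {φ : StrongDual 𝕜 (lp (fun _ : S => 𝕜) 1)} {m : S}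
    (h : m ∈ maxCoords δ φ) : δ < ‖φ (unitVec 𝕜 m)‖ :=
  (show Maximal (fun s => δ < ‖φ (unitVec 𝕜 s)‖) m from h).1

/-- Going up lowers the rank, so a large coordinate of minimal rank above `s` is maximal. -/
theorem exists_maxCoords_ge {ρ : S → Ordinal.{v}} (hρ : StrictAnti ρ) {δ : ℝ}
    {φ : StrongDual 𝕜 (lp (fun _ : S => 𝕜) 1)} {s : S} (hs : δ < ‖φ (unitVec 𝕜 s)‖) :
    ∃ m ∈ maxCoords δ φ, s ≤ m := by
  have hwf : WellFounded (fun a b : S => ρ a < ρ b) := InvImage.wf ρ wellFounded_lt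
  obtain ⟨m, ⟨hm, hsm⟩, hmin⟩ := hwf.has_min
    {t | δ < ‖φ (unitVec 𝕜 t)‖ ∧ s ≤ t} ⟨s, hs, le_rfl⟩
  refine ⟨m, ⟨hm, fun t ht hmt => ?_⟩, hsm⟩
  by_contra hle
  exact hmin t ⟨ht, hsm.trans hmt⟩ (hρ (hmt.lt_of_not_ge hle))

variable [LocallyFiniteOrderBot S]

/-- Each maximal coordinate contributes more than `δ` to an antichain sum bounded by 1. -/
theorem finite_maxCoords {w : S → ℝ} {hw : ∀ p, ‖w p‖ ≤ 1}
    {φ : StrongDual 𝕜 (lp (fun _ : S => 𝕜) 1)} (hφ : φ ∈ adjointImageBall (pathSum 𝕜 w hw))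
    (htree : ∀ a b c : S, a ≤ c → b ≤ c → a ≤ b ∨ b ≤ a) {δ : ℝ} (hδ : 0 < δ) :
    (maxCoords δ φ).Finite ∧ (maxCoords δ φ).ncard ≤ ⌊δ⁻¹⌋₊ := by
  have key (A : Finset S) (hA : (A : Set S) ⊆ maxCoords δ φ) : A.card ≤ ⌊δ⁻¹⌋₊ := by
    have h1 := sum_norm_le_of_mem_adjointImageBall_pathSum hφ
      ((isAntichain_maxCoords δ φ).subset hA) htree zero_le_one fun p _ => hw p
    have h2 : A.card • δ ≤ ∑ s ∈ A, ‖φ (unitVec 𝕜 s)‖ :=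
      Finset.card_nsmul_le_sum _ _ _ fun s hs => (lt_of_mem_maxCoords (hA hs)).le
    apply Nat.le_floor
    rw [nsmul_eq_mul] at h2
    rw [← one_div, le_div_iff₀ hδ]
    exact h2.trans h1
  have hfin : (maxCoords δ φ).Finite := by
    by_contra hinf
    obtain ⟨A, hA, hcard⟩ := Set.Infinite.exists_subset_card_eq hinf (⌊δ⁻¹⌋₊ + 1)
    have := key A hA
    omega
  refine ⟨hfin, ?_⟩
  rw [Set.ncard_eq_toFinset_card _ hfin]
  exact key _ (by simp)

/-- If the nodes of a forest with weight at least `δ` have rank less than `θ`, then the iterated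
Szlenk derivations of the adjoint image of the ball stop by the multiple `⌊1/δ⌋` of `θ` for the
natural sum. -/
theorem szlenkIter_pathSum_le {w : S → ℝ} {hw : ∀ p, ‖w p‖ ≤ 1}
    (htree : ∀ a b c : S, a ≤ c → b ≤ c → a ≤ b ∨ b ≤ a)
    (hwmono : ∀ s p : S, s ≤ p → w p = w s) {ρ : S → Ordinal.{v}} (hρ : StrictAnti ρ)
    {δ : ℝ} (hδ : 0 < δ) {θ : Ordinal.{v}} (hθ : ∀ s, δ < ‖w s‖ → ρ s < θ)
    {γ : Ordinal.{v}} {φ : StrongDual 𝕜 (lp (fun _ : S => 𝕜) 1)}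
    (hφ : φ ∈ szlenkIter (2 * δ) (adjointImageBall (pathSum 𝕜 w hw)) γ) :
    γ ≤ Ordinal.ofCoeff (∑ᶠ m ∈ maxCoords δ φ, Ordinal.toCoeff (ρ m) +
      (⌊δ⁻¹⌋₊ - (maxCoords δ φ).ncard) • Ordinal.toCoeff θ) := by
  classical
  induction γ using Ordinal.limitRecOn generalizing φ with
  | zero => exact zero_le
  | limit γ hγ ih =>
    refine le_of_forall_lt fun β hβ => ?_
    simp only [szlenkIter_limit _ _ hγ, Set.mem_iInter] at hφ
    have := hφ (β + 1) (hγ.add_one_lt hβ)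
    exact Order.add_one_le_iff.1 (ih (β + 1) (hγ.add_one_lt hβ) this)
  | add_one γ ih =>
    rw [szlenkIter_add_one] at hφ
    have hmemK {ψ} (h : ψ ∈ szlenkIter (2 * δ) (adjointImageBall (pathSum 𝕜 w hw)) γ) :=
      szlenkIter_subset _ _ _ h
    obtain ⟨hfin, hcard⟩ := finite_maxCoords (hmemK hφ.1) htree hδ
    set M := hfin.toFinset with hM
    set D := M.biUnion Finset.Iic with hD
    -- Functionals in `V` stay large on `M` and are `δ`-close to `φ` on the finite down-closure `D`
    -- of `M`. Two of them at distance more than `2 * δ` must therefore differ outside `D`, so one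
    -- has a large coordinate at a node lying below no element of `M`.
    set V : Set (WeakDual 𝕜 (lp (fun _ : S => 𝕜) 1)) :=
      (⋂ m ∈ M, {ψ | δ < ‖ψ (unitVec 𝕜 m)‖}) ∩
        ⋂ s ∈ D, {ψ | ‖ψ (unitVec 𝕜 s) - φ (unitVec 𝕜 s)‖ < δ} with hV
    have hVo : IsOpen V := by
      refine IsOpen.inter ?_ ?_
      · exact isOpen_biInter_finset fun m _ =>
          isOpen_lt continuous_const (WeakDual.eval_continuous _).norm
      · exact isOpen_biInter_finset fun m _ =>
          isOpen_lt ((WeakDual.eval_continuous _).sub continuous_const).norm continuous_const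
    have hφV : StrongDual.toWeakDual φ ∈ V := by
      refine ⟨Set.mem_iInter₂.2 fun m hm => ?_, Set.mem_iInter₂.2 fun s _ => ?_⟩
      · exact lt_of_mem_maxCoords (hfin.mem_toFinset.1 hm)
      · simpa using hδ
    obtain ⟨g, hg, h, hh, hgh⟩ := exists_dist_gt_of_lt_ediam (hφ.2 V hVo hφV)
    obtain ⟨t, ht⟩ : ∃ t, 2 * δ < ‖g (unitVec 𝕜 t) - h (unitVec 𝕜 t)‖ := by
      by_contra! hc
      rw [dist_eq_norm] at hgh
      exact hgh.not_ge (lp_one_dual_norm_le (g - h) (by positivity) hc)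
    have htD : t ∉ D := by
      intro htD
      have h1 : ‖g (unitVec 𝕜 t) - φ (unitVec 𝕜 t)‖ < δ := Set.mem_iInter₂.1 hg.2.2 t htD
      have h2 : ‖h (unitVec 𝕜 t) - φ (unitVec 𝕜 t)‖ < δ := Set.mem_iInter₂.1 hh.2.2 t htD
      have := norm_sub_le (g (unitVec 𝕜 t) - φ (unitVec 𝕜 t)) (h (unitVec 𝕜 t) - φ (unitVec 𝕜 t))
      rw [sub_sub_sub_cancel_right] at this
      linarith
    obtain ⟨f, hf, hft⟩ : ∃ f, f ∈ szlenkIter (2 * δ) (adjointImageBall (pathSum 𝕜 w hw)) γ ∩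
        StrongDual.toWeakDual ⁻¹' V ∧ δ < ‖f (unitVec 𝕜 t)‖ := by
      by_contra! hc
      have := norm_sub_le (g (unitVec 𝕜 t)) (h (unitVec 𝕜 t))
      linarith [hc g hg, hc h hh]
    obtain ⟨hfin', hcard'⟩ := finite_maxCoords (hmemK hf.1) htree hδ
    refine Order.add_one_le_iff.2 ((ih hf.1).trans_lt (Ordinal.ofCoeff_strictMono ?_))
    rw [finsum_mem_eq_finite_toFinset_sum _ hfin, finsum_mem_eq_finite_toFinset_sum _ hfin',
      Set.ncard_eq_toFinset_card _ hfin, Set.ncard_eq_toFinset_card _ hfin']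
    obtain ⟨t', ht', htt'⟩ := exists_maxCoords_ge hρ hft
    refine sum_rank_lt_sum_rank (ρ := fun m => Ordinal.toCoeff (ρ m)) (t := t')
      (Ordinal.toCoeff_strictMono.comp_strictAnti hρ) htree ?_ ?_ ?_ ?_ ?_ ?_
    · simpa using isAntichain_maxCoords δ φ
    · rwa [← Set.ncard_eq_toFinset_card _ hfin']
    · intro m hm
      refine Ordinal.toCoeff_strictMono (hθ m ?_)
      refine (lt_of_mem_maxCoords (hfin'.mem_toFinset.1 hm)).trans_le ?_
      exact norm_apply_unitVec_le_of_mem_adjointImageBall_pathSum (hmemK hf.1) htree hwmono m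
    · intro m hm
      obtain ⟨m', hm', hle⟩ := exists_maxCoords_ge hρ (Set.mem_iInter₂.1 hf.2.1 m hm)
      exact ⟨m', hfin'.mem_toFinset.2 hm', hle⟩
    · exact hfin'.mem_toFinset.2 ht'
    · intro m hm hle
      exact htD (Finset.mem_biUnion.2 ⟨m, hm, Finset.mem_Iic.2 (htt'.trans hle)⟩)

theorem szlenkIndex_pathSum_subset {w : S → ℝ} {hw : ∀ p, ‖w p‖ ≤ 1}
    (htree : ∀ a b c : S, a ≤ c → b ≤ c → a ≤ b ∨ b ≤ a)
    (hwmono : ∀ s p : S, s ≤ p → w p = w s) {ρ : S → Ordinal.{v}} (hρ : StrictAnti ρ)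
    {e : Ordinal.{v}} (hθ : ∀ δ > 0, ∃ θ < Ordinal.omega0 ^ e, ∀ s, δ < ‖w s‖ → ρ s < θ) :
    szlenkIndex (adjointImageBall (pathSum 𝕜 w hw)) ⊆ Set.Iio (Ordinal.omega0 ^ e) := by
  classical
  intro γ hγ
  obtain ⟨ε, hε, φ, hφ⟩ := Set.mem_iUnion₂.1 hγ
  obtain ⟨θ, hθe, hθ⟩ := hθ (ε / 2) (by positivity)
  -- The previous bound is applied with `δ = ε / 2`.
  rw [← mul_div_cancel₀ ε (two_ne_zero (α := ℝ))] at hφ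
  refine (szlenkIter_pathSum_le htree hwmono hρ (by positivity) hθ hφ).trans_lt ?_
  obtain ⟨hfin, hcard⟩ :=
    finite_maxCoords (szlenkIter_subset _ _ _ hφ) htree (half_pos hε)
  refine lt_of_le_of_lt (Ordinal.ofCoeff_strictMono.monotone ?_)
    (Ordinal.ofCoeff_nsmul_toCoeff_lt hθe ⌊(ε / 2)⁻¹⌋₊)
  rw [finsum_mem_eq_finite_toFinset_sum _ hfin]
  have h1 : ∑ m ∈ hfin.toFinset, Ordinal.toCoeff (ρ m) ≤
      hfin.toFinset.card • Ordinal.toCoeff θ := by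
    refine Finset.sum_le_card_nsmul _ _ _ fun m hm => ?_
    refine (Ordinal.toCoeff_strictMono (hθ m ?_)).le
    refine (lt_of_mem_maxCoords (hfin.mem_toFinset.1 hm)).trans_le ?_
    exact norm_apply_unitVec_le_of_mem_adjointImageBall_pathSum (szlenkIter_subset _ _ _ hφ)
      htree hwmono m
  rw [← Set.ncard_eq_toFinset_card _ hfin] at h1
  calc _ ≤ _ := add_le_add_left h1 _
    _ = _ := by rw [← add_nsmul, Nat.add_sub_cancel' hcard]

end UpperBound

/-! ### Lower bound for the Szlenk index -/

section LowerBound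

variable {𝕜 : Type} [RCLike 𝕜] {S : Type u} [PartialOrder S] [LocallyFiniteOrderBot S]

/-- The adjoint image of the evaluation at the node `p`. -/
noncomputable def pathEval (𝕜 : Type) [RCLike 𝕜] (w : S → ℝ) (hw : ∀ p, ‖w p‖ ≤ 1) (p : S) :
    StrongDual 𝕜 (lp (fun _ : S => 𝕜) 1) :=
  (lp.evalCLM 𝕜 (fun _ : S => 𝕜) ∞ p).comp (pathSum 𝕜 w hw)

theorem pathEval_apply (w : S → ℝ) (hw : ∀ p, ‖w p‖ ≤ 1) (p : S)
    (x : lp (fun _ : S => 𝕜) 1) :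
    pathEval 𝕜 w hw p x = (w p : 𝕜) * ∑ s ∈ Finset.Iic p, x s := rfl

theorem pathEval_mem (w : S → ℝ) (hw : ∀ p, ‖w p‖ ≤ 1) (p : S) :
    pathEval 𝕜 w hw p ∈ adjointImageBall (pathSum 𝕜 w hw) := by
  refine ⟨_, ?_, rfl⟩
  rw [mem_closedBall_zero_iff]
  refine ContinuousLinearMap.opNorm_le_bound _ zero_le_one fun x => ?_
  rw [one_mul]
  exact lp.norm_apply_le_norm (by simp) x p

/-- The evaluations at `q k` and `p` differ by `w p` times the coordinate at `q k`. This tends to 0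
on each vector of `ℓ₁(S)`, yet the difference has norm at least `‖w p‖ > ε`, so `p` survives one
derivation more than its children. -/
theorem pathEval_mem_szlenkIter {w : S → ℝ} {hw : ∀ p, ‖w p‖ ≤ 1} {ε : ℝ} (hε : 0 ≤ ε)
    {ρ : S → Ordinal.{v}} (hsucc : ∀ p : S, ∀ γ < ρ p, ∃ q : ℕ → S, q.Injective ∧
      ∀ k, γ ≤ ρ (q k) ∧ w (q k) = w p ∧ q k ∉ Finset.Iic p ∧
        ∀ s, s ∈ Finset.Iic (q k) ↔ s = q k ∨ s ∈ Finset.Iic p)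
    (γ : Ordinal.{v}) (p : S) (hp : ε < ‖w p‖) (hγ : γ ≤ ρ p) :
    pathEval 𝕜 w hw p ∈ szlenkIter ε (adjointImageBall (pathSum 𝕜 w hw)) γ := by
  classical
  induction γ using Ordinal.limitRecOn generalizing p with
  | zero =>
    rw [szlenkIter_zero]
    exact pathEval_mem w hw p
  | limit γ hlim ih =>
    rw [szlenkIter_limit _ _ hlim]
    exact Set.mem_iInter₂.2 fun β hβ => ih β hβ p hp (hβ.le.trans hγ)
  | add_one γ ih =>
    rw [szlenkIter_add_one]
    have hγ' := Order.add_one_le_iff.1 hγ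
    refine ⟨ih p hp hγ'.le, fun V hV hpV => ?_⟩
    obtain ⟨q, hq, hqk⟩ := hsucc p γ hγ'
    have hval (k : ℕ) (x : lp (fun _ : S => 𝕜) 1) :
        pathEval 𝕜 w hw (q k) x = pathEval 𝕜 w hw p x + (w p : 𝕜) * x (q k) := by
      obtain ⟨-, h2, h3, h4⟩ := hqk k
      have : Finset.Iic (q k) = insert (q k) (Finset.Iic p) := by
        ext s
        rw [h4, Finset.mem_insert]
      rw [pathEval_apply, pathEval_apply, h2, this, Finset.sum_insert h3, mul_add, add_comm]
    have hlim : Filter.Tendsto (fun k => StrongDual.toWeakDual (pathEval 𝕜 w hw (q k)))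
        Filter.atTop (nhds (StrongDual.toWeakDual (pathEval 𝕜 w hw p))) := by
      refine tendsto_iff_forall_eval_tendsto_topDualPairing.2 fun x => ?_
      change Filter.Tendsto (fun k => pathEval 𝕜 w hw (q k) x) _ (nhds (pathEval 𝕜 w hw p x))
      simp only [hval]
      have hx : Filter.Tendsto (fun k => x (q k)) Filter.atTop (nhds 0) :=
        tendsto_zero_iff_norm_tendsto_zero.2
          ((lp_one_hasSum_norm x).summable.comp_injective hq).tendsto_atTop_zero
      simpa using (hx.const_mul (w p : 𝕜)).const_add (pathEval 𝕜 w hw p x)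
    obtain ⟨k, hk⟩ := (hlim.eventually (hV.mem_nhds hpV)).exists
    obtain ⟨h1, h2, h3, h4⟩ := hqk k
    refine lt_ediam_of_dist_gt hε (y := pathEval 𝕜 w hw (q k)) (z := pathEval 𝕜 w hw p)
      ⟨ih (q k) (h2 ▸ hp) h1, hk⟩ ⟨ih p hp hγ'.le, hpV⟩ ?_
    rw [dist_eq_norm]
    refine hp.trans_le ?_
    have hunit : ‖unitVec 𝕜 (q k)‖ = 1 := by
      rw [unitVec, lp.norm_single (by simp), norm_one]
    have := (pathEval 𝕜 w hw (q k) - pathEval 𝕜 w hw p).le_opNorm (unitVec 𝕜 (q k))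
    rwa [sub_apply, hval, add_sub_cancel_left, unitVec_self, mul_one, hunit,
      mul_one, RCLike.norm_ofReal, ← Real.norm_eq_abs] at this

end LowerBound

/-! ### The forest with prescribed ranks -/

/-- The nodes of a forest: finite lists of labels of decreasing rank (the newest label comes
first, and every label has infinitely many copies), the ranks being less than `θ n` in the `n`-th
tree. -/
@[ext]
structure ForestNode {κ : Type u} (r : κ → Ordinal.{u}) (θ : ℕ → Ordinal.{u}) : Type u where
  tree : ℕ
  path : List (κ × ℕ)
  sorted : path.Pairwise fun a b => r a.1 < r b.1
  bounded : ∀ a ∈ path, r a.1 < θ tree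

namespace ForestNode

variable {κ : Type u} {r : κ → Ordinal.{u}} {θ : ℕ → Ordinal.{u}}

instance : PartialOrder (ForestNode r θ) where
  le s t := s.tree = t.tree ∧ s.path <:+ t.path
  le_refl s := ⟨rfl, List.suffix_rfl⟩
  le_trans _ _ _ h h' := ⟨h.1.trans h'.1, h.2.trans h'.2⟩
  le_antisymm _ _ h h' := ForestNode.ext h.1 (h.2.eq_of_length_le h'.2.length_le)

theorem le_def {s t : ForestNode r θ} : s ≤ t ↔ s.tree = t.tree ∧ s.path <:+ t.path := Iff.rfl

theorem finite_Iic (p : ForestNode r θ) : (Set.Iic p).Finite := by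
  classical
  refine Set.Finite.of_finite_image (f := ForestNode.path)
    (p.path.tails.toFinset.finite_toSet.subset ?_) ?_
  · rintro _ ⟨s, hs, rfl⟩
    simpa using hs.2
  · exact fun s hs t ht hst => ForestNode.ext (hs.1.trans ht.1.symm) hst

noncomputable instance : LocallyFiniteOrderBot (ForestNode r θ) :=
  open Classical in
  LocallyFiniteOrderBot.ofIic _ (fun p => (finite_Iic p).toFinset) fun p s => by simp

theorem le_or_le_of_le (a b c : ForestNode r θ) (ha : a ≤ c) (hb : b ≤ c) : a ≤ b ∨ b ≤ a :=
  (List.suffix_or_suffix_of_suffix ha.2 hb.2).imp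
    (⟨ha.1.trans hb.1.symm, ·⟩) (⟨hb.1.trans ha.1.symm, ·⟩)

/-- The rank of a node: the rank of its newest label, or `θ n` for the root of the `n`-th tree. -/
def rank (s : ForestNode r θ) : Ordinal.{u} :=
  match s.path with
  | [] => θ s.tree
  | a :: _ => r a.1

theorem rank_le (s : ForestNode r θ) : s.rank ≤ θ s.tree := by
  rcases s with ⟨n, _ | ⟨a, l⟩, h1, h2⟩
  · exact le_rfl
  · exact (h2 a List.mem_cons_self).le

theorem rank_strictAnti : StrictAnti (rank : ForestNode r θ → Ordinal.{u}) := by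
  rintro ⟨n, l, hl, hlb⟩ ⟨m, l', hl', hlb'⟩ hlt
  obtain ⟨⟨hnm : n = m, hsuf : l <:+ l'⟩, hne⟩ := lt_iff_le_and_ne.1 hlt
  subst hnm
  obtain ⟨_ | ⟨b, l₁⟩, rfl⟩ := hsuf
  · exact absurd rfl hne
  cases l with
  | nil => exact hlb' b (by simp)
  | cons a l => exact (List.pairwise_cons.1 hl').1 a (by simp)

theorem lt_of_lt_rank {s : ForestNode r θ} {γ : Ordinal.{u}} (h : γ < s.rank) :
    ∀ a ∈ s.path, γ < r a.1 := by
  rcases s with ⟨n, _ | ⟨b, l⟩, h1, h2⟩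
  · simp
  · intro a ha
    rcases List.mem_cons.1 ha with rfl | ha
    · exact h
    · exact lt_trans h ((List.pairwise_cons.1 h1).1 a ha)

/-- The node obtained by adding the label `(k, j)`. -/
def cons (s : ForestNode r θ) (k : κ) (j : ℕ) (h : r k < s.rank) : ForestNode r θ where
  tree := s.tree
  path := (k, j) :: s.path
  sorted := List.pairwise_cons.2 ⟨lt_of_lt_rank h, s.sorted⟩
  bounded := by
    intro a ha
    rcases List.mem_cons.1 ha with rfl | ha
    · exact h.trans_le s.rank_le
    · exact s.bounded a ha

/-- Provides the successors required by the lower bound: the copies `(k, j)`, `j : ℕ`, of one label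
of rank `γ` give infinitely many children. -/
theorem exists_cons {o : Ordinal.{u}} (hr : ∀ γ < o, ∃ k, r k = γ) (hθ : ∀ n, θ n ≤ o)
    (p : ForestNode r θ) (γ : Ordinal.{u}) (hγ : γ < p.rank) :
    ∃ q : ℕ → ForestNode r θ, q.Injective ∧ ∀ j, γ ≤ (q j).rank ∧ (q j).tree = p.tree ∧
      q j ∉ Finset.Iic p ∧ ∀ s, s ∈ Finset.Iic (q j) ↔ s = q j ∨ s ∈ Finset.Iic p := by
  obtain ⟨k, rfl⟩ := hr γ (hγ.trans_le (p.rank_le.trans (hθ _)))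
  refine ⟨fun j => p.cons k j hγ, fun i j hij => ?_, fun j => ⟨le_rfl, rfl, fun h => ?_, fun s => ?_⟩⟩
  · have := congrArg ForestNode.path hij
    simpa [cons] using this
  · have := (Finset.mem_Iic.1 h).2.length_le
    simp [cons] at this
  · rw [Finset.mem_Iic, Finset.mem_Iic, le_def, le_def]
    simp only [cons, List.suffix_cons_iff, ForestNode.ext_iff]
    tauto

/-- The weight of the nodes of the `n`-th tree is `1 / (n + 1)`. -/
noncomputable def weight (s : ForestNode r θ) : ℝ := 1 / ((s.tree : ℝ) + 1)

theorem norm_weight (s : ForestNode r θ) : ‖s.weight‖ = 1 / ((s.tree : ℝ) + 1) :=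
  Real.norm_of_nonneg (by unfold weight; positivity)

theorem norm_weight_le_one (s : ForestNode r θ) : ‖s.weight‖ ≤ 1 := by
  rw [norm_weight, div_le_one (by positivity)]
  linarith [s.tree.cast_nonneg (α := ℝ)]

end ForestNode

/-! ### Polynomial against exponential growth -/

theorem exists_rank_surjective (o : Ordinal.{u}) :
    ∃ (κ : Type u) (r : κ → Ordinal.{u}), ∀ γ < o, ∃ k, r k = γ :=
  ⟨o.ToType, fun k => (Ordinal.ToType.toOrd k).1, fun γ hγ =>
    ⟨Ordinal.ToType.mk ⟨γ, hγ⟩, by simp [Ordinal.ToType.toOrd]⟩⟩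

/-- Exponential beats polynomial: with `t = k + 1` and `x = c * (κ / t) ^ p`, the crude bound `(1 -
x) ^ (2 ^ k) ≤ 1 / (2 ^ k * x)` suffices, because `t ^ (p + 1) / 2 ^ k` tends to 0. -/
theorem exists_two_mul_pow_le {c κ p : ℝ} (hc : c ∈ Set.Ioo (0 : ℝ) 1) (hκ : κ ∈ Set.Ioo (0 : ℝ) 1)
    (hp : 1 ≤ p) :
    ∃ k : ℕ, 2 * (1 - c * (κ / ((k : ℝ) + 1)) ^ p) ^ (2 ^ k) ≤ κ / ((k : ℝ) + 1) := by
  obtain ⟨hc0, hc1⟩ := hc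
  obtain ⟨hκ0, hκ1⟩ := hκ
  set m := ⌈p⌉₊ + 1 with hm
  have hlim := (Filter.tendsto_add_atTop_iff_nat 1).2
    (tendsto_pow_const_div_const_pow_of_one_lt m (one_lt_two (α := ℝ)))
  have hpos : 0 < c * κ ^ p * κ / 4 := by positivity
  obtain ⟨k, hk⟩ := (hlim.eventually (gt_mem_nhds hpos)).exists
  refine ⟨k, ?_⟩
  push_cast at hk
  set t : ℝ := (k : ℝ) + 1 with ht
  have ht1 : 1 ≤ t := by rw [ht]; linarith [k.cast_nonneg (α := ℝ)]
  have ht0 : 0 < t := by linarith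
  have htp : t ^ p * t ≤ t ^ m := by
    rw [hm, pow_succ, ← Real.rpow_natCast]
    gcongr
    exact Nat.le_ceil p
  set x := c * (κ / t) ^ p with hx
  have hx0 : 0 < x := by positivity
  have hx1 : x ≤ 1 := by
    have : (κ / t) ^ p ≤ 1 := Real.rpow_le_one (by positivity)
      ((div_le_one ht0).2 (by linarith)) (by linarith)
    nlinarith
  have hy0 : 0 < (2 : ℝ) ^ k * x := by positivity
  have h1 : (1 - x) ^ (2 ^ k) ≤ ((2 : ℝ) ^ k * x)⁻¹ := by
    calc (1 - x) ^ (2 ^ k) ≤ Real.exp (-x) ^ (2 ^ k) := by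
          exact pow_le_pow_left₀ (by linarith) (Real.one_sub_le_exp_neg x) _
      _ = (Real.exp ((2 : ℝ) ^ k * x))⁻¹ := by
          rw [← Real.exp_nat_mul, ← Real.exp_neg]
          push_cast
          ring_nf
      _ ≤ ((2 : ℝ) ^ k * x)⁻¹ := by
          gcongr
          linarith [Real.add_one_le_exp ((2 : ℝ) ^ k * x)]
  have h2 : 2 * t ≤ κ * ((2 : ℝ) ^ k * x) := by
    rw [div_lt_iff₀ (by positivity), pow_succ (2 : ℝ)] at hk
    have hkey : 2 * (t ^ p * t) ≤ c * κ ^ p * κ * 2 ^ k := by nlinarith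
    rw [hx, Real.div_rpow hκ0.le ht0.le]
    have htp0 : 0 < t ^ p := by positivity
    calc 2 * t = 2 * (t ^ p * t) / t ^ p := by field_simp
      _ ≤ c * κ ^ p * κ * 2 ^ k / t ^ p := by gcongr
      _ = κ * (2 ^ k * (c * (κ ^ p / t ^ p))) := by ring
  calc 2 * (1 - x) ^ (2 ^ k) ≤ 2 * ((2 : ℝ) ^ k * x)⁻¹ := by gcongr
    _ ≤ κ / t := by
      rw [← div_eq_mul_inv, div_le_div_iff₀ hy0 ht0]
      exact h2

section

variable {𝕜 : Type} [RCLike 𝕜]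

theorem adjointImageBall_id {E : Type u} [NormedAddCommGroup E] [NormedSpace 𝕜 E] :
    adjointImageBall (ContinuousLinearMap.id 𝕜 E) = Metric.closedBall (0 : StrongDual 𝕜 E) 1 := by
  simp [adjointImageBall]

theorem adjointImageBall_comp_subset {E F G : Type u} [NormedAddCommGroup E] [NormedSpace 𝕜 E]
    [NormedAddCommGroup F] [NormedSpace 𝕜 F] [NormedAddCommGroup G] [NormedSpace 𝕜 G]
    (A : E →L[𝕜] F) (B : F →L[𝕜] G) (hB : ‖B‖ ≤ 1) :
    adjointImageBall (B.comp A) ⊆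
      (fun φ : StrongDual 𝕜 F => φ.comp A) '' Metric.closedBall (0 : StrongDual 𝕜 F) 1 := by
  rintro _ ⟨ψ, hψ, rfl⟩
  refine ⟨ψ.comp B, ?_, rfl⟩
  rw [mem_closedBall_zero_iff] at hψ ⊢
  exact (ContinuousLinearMap.opNorm_comp_le _ _).trans (mul_le_one₀ hψ (norm_nonneg _) hB)

/-- An operator that factors through a member of `Pzl` factors through a member of `PzlZero`, the
second factor being a contraction. -/
theorem exists_contraction_factor {α : Ordinal.{u}} {E F D : Ban.{u} 𝕜} (hD : D ∈ Pzl 𝕜 α)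
    (A : E →L[𝕜] D) (B : D →L[𝕜] F) :
    ∃ G ∈ PzlZero 𝕜 α, ∃ (A' : E →L[𝕜] G) (B' : G →L[𝕜] F), ‖B'‖ ≤ 1 ∧
      B.comp A = B'.comp A' := by
  obtain ⟨G, hG, ⟨e⟩⟩ := hD
  -- The norm of the second factor is moved into the first, whose norm is unrestricted.
  set B₀ : G →L[𝕜] F := B.comp (e.symm : G →L[𝕜] D) with hB₀
  set M : ℝ := ‖B₀‖ + 1 with hM
  have hM0 : 0 < M := by positivity
  have hM' : (M : 𝕜) ≠ 0 := by exact_mod_cast hM0.ne'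
  refine ⟨G, hG, (M : 𝕜) • (e : D →L[𝕜] G).comp A, (M : 𝕜)⁻¹ • B₀, ?_, ?_⟩
  · rw [norm_smul, norm_inv, RCLike.norm_ofReal, abs_of_pos hM0, inv_mul_le_iff₀ hM0]
    linarith
  · ext x
    simp [hB₀, hM']

/-- The `ε`-Szlenk indices of an operator that factors through a member of `PzlZero` grow at most
polynomially in `1 / ε`. -/
theorem exists_szlenkIter_eq_empty {α : Ordinal.{u}} {E F G : Ban.{u} 𝕜} (hG : G ∈ PzlZero 𝕜 α)
    (A : E →L[𝕜] G) (B : G →L[𝕜] F) (hB : ‖B‖ ≤ 1) :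
    ∃ k : ℕ, szlenkIter (1 / (2 * ((k : ℝ) + 1))) (adjointImageBall (B.comp A))
      (Ordinal.omega0 ^ α * ((2 ^ k : ℕ) : Ordinal.{u}) + 1) = ∅ := by
  obtain ⟨c, hc, p, hp, h⟩ := hG
  have hA := norm_nonneg A
  -- Chosen so that `ε = κ / (k + 1)` satisfies `2 * ‖A‖ * ε ≤ 1 / (2 * (k + 1))`, the loss in
  -- passing to the image under the adjoint of `A`.
  set κ : ℝ := 1 / (4 * (‖A‖ + 1)) with hκ
  have hκ1 : κ ∈ Set.Ioo (0 : ℝ) 1 :=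
    ⟨by positivity, by rw [hκ, div_lt_one (by positivity)]; linarith⟩
  obtain ⟨k, hk⟩ := exists_two_mul_pow_le hc hκ1 hp
  refine ⟨k, ?_⟩
  have hk0 : 0 < (k : ℝ) + 1 := by positivity
  set ε : ℝ := κ / ((k : ℝ) + 1) with hε
  have hε0 : 0 < ε := div_pos hκ1.1 hk0
  have hε1 : ε < 1 := by
    rw [hε, div_lt_one hk0]
    linarith [hκ1.2, k.cast_nonneg (α := ℝ)]
  have hle : 2 * ‖A‖ * ε ≤ 1 / (2 * ((k : ℝ) + 1)) := by
    rw [hε, hκ, div_div, mul_one_div, div_le_div_iff₀ (by positivity) (by positivity)]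
    nlinarith
  have hεp : ε ^ p ≤ 1 := Real.rpow_le_one hε0.le hε1.le (by linarith)
  have hεp0 : 0 < ε ^ p := by positivity
  -- After `ω ^ α * 2 ^ k` derivations the remaining set has diameter at most `ε`; the extra `+ 1`
  -- empties it.
  have hempty : szlenkIter ε (Metric.closedBall (0 : StrongDual 𝕜 G) 1)
      (Ordinal.omega0 ^ α * ((2 ^ k : ℕ) : Ordinal.{u}) + 1) = ∅ := by
    rw [szlenkIter_add_one]
    exact szlenkDerivation_eq_empty_of_subset_closedBall
      (szlenkIter_mul_natCast_subset hε0.le (by nlinarith [hc.1, hc.2]) (by nlinarith [hc.1])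
        (h ε ⟨hε0, hε1⟩) (2 ^ k)) hk
  refine Set.subset_empty_iff.1 ((szlenkIter_mono (adjointImageBall_comp_subset A B hB) _).trans
    ((szlenkIter_comp_image_subset A hε0.le hle
      (isCompact_toWeakDual_image_closedBall 1) _).trans ?_))
  rw [hempty, Set.image_empty]

/-- There is an operator of Szlenk index at most `ω ^ (α + 1)` whose `1 / (2 (k + 1))`-Szlenk
indices are greater than `ω ^ α * 2 ^ k + 1`. -/
theorem exists_szlenkOp_szlenkIter_nonempty (𝕜 : Type) [RCLike 𝕜] (α : Ordinal.{u}) :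
    ∃ (E F : Ban.{u} 𝕜) (T : E →L[𝕜] F), T ∈ SzlenkOp.{u} 𝕜 (α + 1) E F ∧
      ∀ k : ℕ, (szlenkIter (1 / (2 * ((k : ℝ) + 1))) (adjointImageBall T)
        (Ordinal.omega0 ^ α * ((2 ^ k : ℕ) : Ordinal.{u}) + 1)).Nonempty := by
  obtain ⟨κ, r, hr⟩ := exists_rank_surjective (Ordinal.omega0 ^ (α + 1) : Ordinal.{u})
  set θ : ℕ → Ordinal.{u} := fun k => Ordinal.omega0 ^ α * ((2 ^ k : ℕ) : Ordinal.{u}) + 1 with hθ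
  have hlim : Order.IsSuccLimit (Ordinal.omega0 ^ (α + 1) : Ordinal.{u}) :=
    Ordinal.isSuccLimit_opow_left Ordinal.isSuccLimit_omega0 (by simp)
  have hθlt (k : ℕ) : θ k < Ordinal.omega0 ^ (α + 1) := by
    refine hlim.add_one_lt ?_
    rw [Ordinal.opow_add, Ordinal.opow_one]
    exact mul_lt_mul_of_pos_left (Ordinal.natCast_lt_omega0 _)
      (Ordinal.opow_pos _ Ordinal.omega0_pos)
  have hθmono : Monotone θ := fun m n hmn => by
    have : ((2 ^ m : ℕ) : Ordinal.{u}) ≤ ((2 ^ n : ℕ) : Ordinal.{u}) :=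
      Nat.cast_le.2 (Nat.pow_le_pow_right two_pos hmn)
    exact add_le_add_left (mul_le_mul_right this _) 1
  set T := pathSum 𝕜 (ForestNode.weight (r := r) (θ := θ)) ForestNode.norm_weight_le_one with hT
  refine ⟨⟨lp (fun _ : ForestNode r θ => 𝕜) 1⟩, ⟨lp (fun _ : ForestNode r θ => 𝕜) ∞⟩, T, ?_,
    fun k => ?_⟩
  · refine szlenkIndex_pathSum_subset ForestNode.le_or_le_of_le (ρ := ForestNode.rank)
      (fun s p h => ?_) ForestNode.rank_strictAnti fun δ hδ => ?_
    · rw [ForestNode.weight, ForestNode.weight, h.1]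
    -- A weight above `δ` forces the tree number below `δ⁻¹`, and `θ` is monotone.
    · refine ⟨θ ⌈δ⁻¹⌉₊ + 1, hlim.add_one_lt (hθlt _), fun s hs => ?_⟩
      refine Order.lt_add_one_iff.2 (s.rank_le.trans (hθmono ?_))
      rw [ForestNode.norm_weight, lt_one_div hδ (by positivity), one_div] at hs
      have : (s.tree : ℝ) ≤ ⌈δ⁻¹⌉₊ := by linarith [Nat.le_ceil δ⁻¹]
      exact_mod_cast this
  -- The witness is the root of the `k`-th tree: its rank is `θ k`, and its weight `1 / (k + 1)`
  -- strictly exceeds `1 / (2 * (k + 1))`.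
  · refine ⟨_, pathEval_mem_szlenkIter (by positivity) (ρ := ForestNode.rank)
      (fun p γ hγ => ?_) _ ⟨k, [], List.Pairwise.nil, by simp⟩ ?_ le_rfl⟩
    · obtain ⟨q, hq, h⟩ := ForestNode.exists_cons hr (fun n => (hθlt n).le) p γ hγ
      refine ⟨q, hq, fun j => ⟨(h j).1, ?_, (h j).2.2⟩⟩
      rw [ForestNode.weight, ForestNode.weight, (h j).2.1]
    · rw [ForestNode.norm_weight]
      have hk : 0 < (k : ℝ) + 1 := by positivity
      exact one_div_lt_one_div_of_lt hk (by linarith)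

end

theorem proposition5p1 (𝕜 : Type) [RCLike 𝕜] (α : Ordinal.{u}) :
    ¬ (Szl.{u} 𝕜 (α + 1) = Pzl.{u} 𝕜 α ∧
        HasFactorizationProperty.{u} (SzlenkOp.{u} 𝕜 (α + 1))) := by
  rintro ⟨hSP, hfac⟩
  obtain ⟨E, F, T, hT, hne⟩ := exists_szlenkOp_szlenkIter_nonempty 𝕜 α
  obtain ⟨D, hD, A, B, rfl⟩ := hfac E F hT
  have hDS : D ∈ Szl 𝕜 (α + 1) := by
    have hD' : szlenkIndex (adjointImageBall (ContinuousLinearMap.id 𝕜 D)) ⊆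
      Set.Iio (Ordinal.omega0 ^ (α + 1)) := hD
    rwa [adjointImageBall_id] at hD'
  rw [hSP] at hDS
  obtain ⟨G, hG, A', B', hB', hcomp⟩ := exists_contraction_factor hDS A B
  obtain ⟨k, hk⟩ := exists_szlenkIter_eq_empty hG A' B' hB'
  rw [← hcomp] at hk
  exact (hne k).ne_empty hk
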